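/- Fix a finite set $A$ of modalities. Formulas are built from variables $p_0,p_1,\dots$ with Boolean connectives and the unary connectives $\Diamond\in A$; a $k$-formula uses only variables $p_i$ with $i<k$. A \emph{logic} over $A$ is a normal modal logic: a set of formulas that contains all classical tautologies and, for each $\Diamond\in A$, the formulas $\neg\Diamond\bot$ and $\Diamond(p_0\vee p_1)\to\Diamond p_0\vee\Diamond p_1$, and is closed under modus ponens, substitution and monotonicity ($\varphi\to\psi\in L$ implies $\Diamond\varphi\to\Diamond\psi\in L$). An \emph{extension} of $L_0$ is a logic $L\supseteq L_0$ over the same $A$. For $B\subseteq A$, $L^{\restriction B}$ is the set of formulas over $B$ that belong to $L$. A logic $L$ is \emph{$k$-finite} if it has only finitely many pairwise non-$L$-equivalent $k$-formulas, and \emph{locally tabular} if it is $k$-finite for all $k<\omega$. Put $\Diamond_A\varphi=\bigvee_{\Diamond\in A}\Diamond\varphi$ and $\Diamond_A^{\le m}\varphi=\bigvee_{i\le m}\Diamond_A^i\varphi$. The logic $L$ is \emph{pretransitive} if $\Diamond_A^{m+1}p\to\Diamond_A^{\le m}p\in L$ for some $m<\omega$. In this case let $m$ be the least such number, write $\Diamond^*$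 for $\Diamond_A^{\le m}$ and $\Box^*$ for $\neg\Diamond^*\neg$, and let $B_0^*=\bot$, $B_{h}^*=p_{h}\to\Box^*(\Diamond^*p_{h}\vee B_{h-1}^*)$ for $h\ge 1$. The \emph{height} of $L$ is the least $h$ with $B^*_h\in L$; it is infinite if there is no such $h$ or if $L$ is not pretransitive. (For $L^{\restriction B}$ these notions are taken over the alphabet $B$.) The \emph{canonical frame} of $L$ is the Kripke frame whose points are the maximal $L$-consistent sets of formulas (equivalently, the ultrafilters of the Lindenbaum algebra of $L$ over all variables), with $\Gamma R_\Diamond\Delta$ iff $\Diamond\varphi\in\Gamma$ for all $\varphi\in\Delta$. The logic $L$ is \emph{canonical} if it is valid in its canonical frame. A \emph{cluster} in a Kripke frame $F=(X,(R_\Diamond)_{\Diamond\in A})$ ($X$ may be empty) is an equivalence class of the relation ``$xR_F^*y$ and $yR_F^*x$'', where $R_F^*$ is the reflexive transitive closure of $\bigcup_{\Diamond\in A} R_\Diamond$. A partition $\mathcal U$ of $X$ is \emph{tuned} if for all $\Diamond\in A$ and $U,V\in\mathcal U$: if $xR_\Diamond y$ for some $x\in U$, $y\in V$, then for every $x\in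 U$ there is $y\in V$ with $xR_\Diamond y$. A class $\mathcal F$ of frames is \emph{uniformly tunable} if there is $f:\omega\to\omega$ such that for every $F\in\mathcal F$, each finite partition $\mathcal V$ of the domain of $F$ has a tuned refinement $\mathcal U$ with $|\mathcal U|\le f(|\mathcal V|)$. A logic $L$ has the \emph{ripe cluster property} if the class of all restrictions $F\restriction C$, where $F$ is a Kripke frame validating $L$ and $C$ is a cluster in $F$, is uniformly tunable. \textbf{Theorem.} Let $L_0$ be a canonical pretransitive logic over $A$ with the ripe cluster property. Then: 1. for every extension $L$ of $L_0$, $L$ is locally tabular if and only if $L$ has finite height; 2. $L_0$ admits the finite height criterion: for every extension $L$ of $L_0$, $L$ is locally tabular if and only if, for each $B\subseteq A$, the height of $L^{\restriction B}$ is finite; 3. $L_0$ admits the 1-finiteness condition: every 1-finite extension of $L_0$ is locally tabular. -/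

import Mathlib

universe u

namespace PolyModal

/-! ### Language -/

/-- Modal formulas over the alphabet of modalities `A`, with variables `p_0, p_1, …`.
The Boolean connectives are generated by falsum and implication. -/
inductive Formula (A : Type u) : Type u
  | var : ℕ → Formula A
  | bot : Formula A
  | imp : Formula A → Formula A → Formula A
  | dia : A → Formula A → Formula A

namespace Formula

variable {A B : Type u}

def neg (φ : Formula A) : Formula A := imp φ bot

def or (φ ψ : Formula A) : Formula A := imp (neg φ) ψ

def and (φ ψ : Formula A) : Formula A := neg (imp φ (neg ψ))

def iff (φ ψ : Formula A) : Formula A := and (imp φ ψ) (imp ψ φ)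

/-- Disjunction of a finite list; the empty disjunction is falsum. -/
def disj : List (Formula A) → Formula A
  | [] => bot
  | φ :: l => or φ (disj l)

/-- Conjunction of a finite list; the empty conjunction is verum. -/
def conj : List (Formula A) → Formula A
  | [] => neg bot
  | φ :: l => and φ (conj l)

/-- Simultaneous substitution of formulas for variables. -/
def subst (σ : ℕ → Formula A) : Formula A → Formula A
  | var n => σ n
  | bot => bot
  | imp φ ψ => imp (subst σ φ) (subst σ ψ)
  | dia a φ => dia a (subst σ φ)

/-- Renaming of modalities. -/
def mapModality (g : B → A) : Formula B → Formula A
  | var n => var n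
  | bot => bot
  | imp φ ψ => imp (mapModality g φ) (mapModality g ψ)
  | dia b φ => dia (g b) (mapModality g φ)

/-- A `k`-formula: all its variables are among `p_i`, `i < k`. -/
def IsKFormula (k : ℕ) : Formula A → Prop
  | var n => n < k
  | bot => True
  | imp φ ψ => IsKFormula k φ ∧ IsKFormula k ψ
  | dia _ φ => IsKFormula k φ

/-- Truth-functional tautologies: true under every assignment of truth values to formulas that
respects the Boolean connectives (that is, the substitution instances of the tautologies of
classical propositional logic). -/
def IsTautology (φ : Formula A) : Prop :=
  ∀ v : Formula A → Prop, ¬ v bot → (∀ ψ χ, v (imp ψ χ) ↔ (v ψ → v χ)) → v φ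

/-- `◇_A φ`: the disjunction of the formulas `◇ φ` over all modalities `◇` in `A`. -/
noncomputable def diaAll [Fintype A] (φ : Formula A) : Formula A :=
  disj ((Finset.univ : Finset A).toList.map fun a => dia a φ)

/-- `◇_A^i φ`. -/
noncomputable def diaIter [Fintype A] : ℕ → Formula A → Formula A
  | 0, φ => φ
  | i + 1, φ => diaAll (diaIter i φ)

/-- `◇_A^{≤ m} φ`. -/
noncomputable def diaLe [Fintype A] (m : ℕ) (φ : Formula A) : Formula A :=
  disj ((List.range (m + 1)).map fun i => diaIter i φ)

/-- `□_A^{≤ m} φ`. -/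
noncomputable def boxLe [Fintype A] (m : ℕ) (φ : Formula A) : Formula A :=
  neg (diaLe m (neg φ))

/-- The formula of `m`-transitivity `◇_A^{m+1} p → ◇_A^{≤ m} p`. -/
noncomputable def transFormula (A : Type u) [Fintype A] (m : ℕ) : Formula A :=
  imp (diaIter (m + 1) (var 0)) (diaLe m (var 0))

/-- The formula of height `h` for the operator `◇_A^{≤ m}`:
`B_0 = ⊥`, `B_h = p_h → □(◇ p_h ∨ B_{h-1})`, where `◇` is read as `◇_A^{≤ m}`. -/
noncomputable def heightFormula (A : Type u) [Fintype A] (m : ℕ) : ℕ → Formula A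
  | 0 => bot
  | h + 1 => imp (var (h + 1))
      (boxLe m (or (diaLe m (var (h + 1))) (heightFormula A m h)))

end Formula

open Formula

/-! ### Kripke frames -/

/-- Kripke frames over the alphabet `A`; the domain may be empty. -/
structure KripkeFrame (A : Type u) : Type (u + 1) where
  carrier : Type u
  rel : A → carrier → carrier → Prop

namespace KripkeFrame

variable {A : Type u}

/-- Truth at a point under the valuation `θ`. -/
def Sat (F : KripkeFrame A) (θ : ℕ → Set F.carrier) : Formula A → F.carrier → Prop
  | .var n, x => x ∈ θ n
  | .bot, _ => False
  | .imp φ ψ, x => F.Sat θ φ x → F.Sat θ ψ x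
  | .dia a φ, x => ∃ y, F.rel a x y ∧ F.Sat θ φ y

def Valid (F : KripkeFrame A) (φ : Formula A) : Prop :=
  ∀ (θ : ℕ → Set F.carrier) (x : F.carrier), F.Sat θ φ x

/-- The frame validates every formula of `L`. -/
def IsFrameOf (F : KripkeFrame A) (L : Set (Formula A)) : Prop :=
  ∀ φ ∈ L, F.Valid φ

/-- The union of all relations of the frame. -/
def unionRel (F : KripkeFrame A) (x y : F.carrier) : Prop := ∃ a, F.rel a x y

/-- The reflexive transitive closure of the union of all relations. -/
def reach (F : KripkeFrame A) : F.carrier → F.carrier → Prop :=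
  Relation.ReflTransGen F.unionRel

/-- `C` is a cluster: an equivalence class of mutual reachability. -/
def IsClusterIn (F : KripkeFrame A) (C : Set F.carrier) : Prop :=
  ∃ x, C = {y | F.reach x y ∧ F.reach y x}

/-- Restriction of a frame to a subset of its domain. -/
def restrict (F : KripkeFrame A) (Y : Set F.carrier) : KripkeFrame A where
  carrier := Y
  rel a x y := F.rel a x.1 y.1

/-- A family of subsets of the domain is tuned, if for each relation `R` and all members `U`, `V`,
if some point of `U` is `R`-related to a point of `V`, then every point of `U` is. -/
def IsTuned (F : KripkeFrame A) (P : Set (Set F.carrier)) : Prop :=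
  ∀ a, ∀ U ∈ P, ∀ V ∈ P,
    (∃ x ∈ U, ∃ y ∈ V, F.rel a x y) → ∀ x ∈ U, ∃ y ∈ V, F.rel a x y

end KripkeFrame

/-- The restrictions of the frames of the class to their clusters. -/
def clusterFrames {A : Type u} (K : Set (KripkeFrame A)) : Set (KripkeFrame A) :=
  {G | ∃ F ∈ K, ∃ C : Set F.carrier, F.IsClusterIn C ∧ G = F.restrict C}

/-- A class of Kripke frames is uniformly tunable, if for some `f : ℕ → ℕ`, every finite partition
`P` of every frame of the class has a finite tuned refinement `Q` with `|Q| ≤ f |P|`. -/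
def UniformlyTunable {A : Type u} (K : Set (KripkeFrame A)) : Prop :=
  ∃ f : ℕ → ℕ, ∀ F ∈ K, ∀ P : Set (Set F.carrier), Setoid.IsPartition P → P.Finite →
    ∃ Q : Set (Set F.carrier), Setoid.IsPartition Q ∧ (∀ U ∈ Q, ∃ V ∈ P, U ⊆ V) ∧
      Q.Finite ∧ Q.ncard ≤ f P.ncard ∧ F.IsTuned Q

/-! ### Normal logics -/

/-- Normal (poly)modal logics over the alphabet `A`. -/
structure IsNormalLogic {A : Type u} (L : Set (Formula A)) : Prop where
  tautology : ∀ φ : Formula A, φ.IsTautology → φ ∈ L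
  dia_bot : ∀ a, neg (dia a bot) ∈ L
  dia_or : ∀ a, imp (dia a (or (var 0) (var 1))) (or (dia a (var 0)) (dia a (var 1))) ∈ L
  modusPonens : ∀ φ ψ, imp φ ψ ∈ L → φ ∈ L → ψ ∈ L
  substitution : ∀ (σ : ℕ → Formula A) (φ), φ ∈ L → subst σ φ ∈ L
  monotonicity : ∀ a φ ψ, imp φ ψ ∈ L → imp (dia a φ) (dia a ψ) ∈ L

/-- `L` is an extension of `L₀`: a normal logic over the same alphabet that contains `L₀`. -/
def IsExtension {A : Type u} (L₀ L : Set (Formula A)) : Prop :=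
  IsNormalLogic L ∧ L₀ ⊆ L

/-- The fragment of `L` consisting of its formulas over the subalphabet `B`. -/
def fragment {A : Type u} (L : Set (Formula A)) (B : Finset A) : Set (Formula B) :=
  {φ | mapModality Subtype.val φ ∈ L}

/-- `L` is `k`-finite: up to `L`-equivalence, there are only finitely many `k`-formulas. -/
def KFinite {A : Type u} (k : ℕ) (L : Set (Formula A)) : Prop :=
  ∃ S : Set (Formula A), S.Finite ∧ ∀ φ : Formula A, φ.IsKFormula k →
    ∃ ψ ∈ S, ψ.IsKFormula k ∧ iff φ ψ ∈ L

def LocallyTabular {A : Type u} (L : Set (Formula A)) : Prop :=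
  ∀ k, KFinite k L

/-- The transitivity index: the least `m` such that `L` contains the formula of `m`-transitivity,
and `⊤` if there is none. -/
noncomputable def transIndex {A : Type u} [Fintype A] (L : Set (Formula A)) : ℕ∞ :=
  sInf {x | ∃ m : ℕ, x = m ∧ transFormula A m ∈ L}

def IsPretransitive {A : Type u} [Fintype A] (L : Set (Formula A)) : Prop :=
  transIndex L < ⊤

/-- The height of `L`: if the transitivity index of `L` is a finite `m`, it is the least `h` such
that `L` contains the formula of height `h` for the operator `◇_A^{≤ m}`. It is `⊤` if there is no
such `h` or if `L` is not pretransitive. -/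
noncomputable def logicHeight {A : Type u} [Fintype A] (L : Set (Formula A)) : ℕ∞ :=
  sInf {x | ∃ m h : ℕ, transIndex L = m ∧ x = h ∧ heightFormula A m h ∈ L}

/-! ### Canonicity -/

/-- `Γ` is `L`-consistent: no finite conjunction of members of `Γ` is refutable in `L`. -/
def IsConsistent {A : Type u} (L Γ : Set (Formula A)) : Prop :=
  ∀ l : List (Formula A), (∀ φ ∈ l, φ ∈ Γ) → neg (conj l) ∉ L

/-- The canonical frame of `L`: its points are the maximal `L`-consistent sets of formulas (that is,
the ultrafilters of the Lindenbaum algebra of `L` over all the variables). -/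
def canonicalFrame {A : Type u} (L : Set (Formula A)) : KripkeFrame A where
  carrier := {Γ : Set (Formula A) // Maximal (IsConsistent L) Γ}
  rel a Γ Δ := ∀ φ ∈ Δ.1, dia a φ ∈ Γ.1

/-- `L` is canonical: it is valid in its canonical frame. -/
def IsCanonical {A : Type u} (L : Set (Formula A)) : Prop :=
  (canonicalFrame L).IsFrameOf L

/-! ### The notions of the theorem -/

/-- Ripe cluster property: the clusters of all frames of `L` are uniformly tunable. -/
def HasRipeClusterProperty {A : Type u} (L : Set (Formula A)) : Prop :=
  UniformlyTunable (clusterFrames {F : KripkeFrame A | F.IsFrameOf L})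

/-- An extension is locally tabular iff its fragments over all subalphabets have finite height. -/
def AdmitsFiniteHeightCriterion {A : Type u} [Fintype A] (L₀ : Set (Formula A)) : Prop :=
  ∀ L, IsExtension L₀ L →
    (LocallyTabular L ↔ ∀ B : Finset A, logicHeight (fragment L B) < ⊤)

/-- Every `k`-finite extension is locally tabular. -/
def AdmitsKFinitenessCondition {A : Type u} (k : ℕ) (L₀ : Set (Formula A)) : Prop :=
  ∀ L, IsExtension L₀ L → KFinite k L → LocallyTabular L

end PolyModal

/-! Two implications carry the theorem: finite height gives local tabularity, and 1-finiteness gives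
finite height. Local tabularity contains 1-finiteness, which passes to fragments, and the fragment
over the full alphabet is `L` up to renaming, so all three claims follow.

Finite height to local tabularity: the canonical frame of `L` is a generated subframe of that of
`L₀`, hence a frame of `L₀`, and its clusters are uniformly tunable. Reachability in it is
determined by `◇^{≤ m}` (`reach_of_forall`), so the height formula bounds the depth of its points
(`mem_depthSet_of_forall`). Induction on depth glues tuned partitions of the clusters into one
finite tuned coloring (`exists_tuned_coloring_depthSet`). If it refines the values of `p_i`, `i <
k`, the color of a point decides all `k`-formulas, so these are finitely many up to equivalence.

1-finiteness to finite height: two of the formulas `◇^{≤ n} p_0` are equivalent, which gives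
pretransitivity. If the height formula for `j` is refuted, the canonical model has a chain along
which a rank takes all values from `j` down to `0`. With "the rank is odd" substituted for `p_0`,
`alternation` of length `k` holds at a chain point exactly when its rank is at least `k`. So
alternations of lengths `i < j` are inequivalent, and by 1-finiteness some height formula lies in
`L`. -/

namespace PolyModal

open Formula

variable {A : Type u}

/-! ### Semantics of the derived connectives -/

namespace KripkeFrame

variable (F : KripkeFrame A) (θ : ℕ → Set F.carrier)

@[simp] theorem sat_imp (φ ψ : Formula A) (x : F.carrier) :
    F.Sat θ (imp φ ψ) x ↔ (F.Sat θ φ x → F.Sat θ ψ x) := Iff.rfl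

@[simp] theorem sat_bot (x : F.carrier) : ¬ F.Sat θ bot x := id

@[simp] theorem sat_var (n : ℕ) (x : F.carrier) : F.Sat θ (var n) x ↔ x ∈ θ n := Iff.rfl

@[simp] theorem sat_dia (a : A) (φ : Formula A) (x : F.carrier) :
    F.Sat θ (dia a φ) x ↔ ∃ y, F.rel a x y ∧ F.Sat θ φ y := Iff.rfl

@[simp] theorem sat_neg (φ : Formula A) (x : F.carrier) :
    F.Sat θ (neg φ) x ↔ ¬ F.Sat θ φ x := Iff.rfl

@[simp] theorem sat_or (φ ψ : Formula A) (x : F.carrier) :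
    F.Sat θ (or φ ψ) x ↔ F.Sat θ φ x ∨ F.Sat θ ψ x := by
  simp only [Formula.or, sat_imp, sat_neg]; tauto

@[simp] theorem sat_and (φ ψ : Formula A) (x : F.carrier) :
    F.Sat θ (and φ ψ) x ↔ F.Sat θ φ x ∧ F.Sat θ ψ x := by
  simp only [Formula.and, sat_imp, sat_neg]; tauto

@[simp] theorem sat_iff (φ ψ : Formula A) (x : F.carrier) :
    F.Sat θ (iff φ ψ) x ↔ (F.Sat θ φ x ↔ F.Sat θ ψ x) := by
  simp only [Formula.iff, sat_and, sat_imp]; tauto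

theorem sat_disj (l : List (Formula A)) (x : F.carrier) :
    F.Sat θ (disj l) x ↔ ∃ φ ∈ l, F.Sat θ φ x := by
  induction l with
  | nil => simp [disj]
  | cons φ l ih => simp [disj, ih]

theorem sat_conj (l : List (Formula A)) (x : F.carrier) :
    F.Sat θ (conj l) x ↔ ∀ φ ∈ l, F.Sat θ φ x := by
  induction l with
  | nil => simp [conj]
  | cons φ l ih => simp [conj, ih]

/-- Existence of a path of the given length along the union of the relations. -/
def steps : ℕ → F.carrier → F.carrier → Prop
  | 0, x, y => x = y
  | i + 1, x, y => ∃ z, F.unionRel x z ∧ steps i z y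

theorem reach_of_steps {i : ℕ} {x y : F.carrier} (h : F.steps i x y) : F.reach x y := by
  induction i generalizing x with
  | zero => cases h; exact .refl
  | succ i ih =>
    obtain ⟨z, hz, h⟩ := h
    exact .head hz (ih h)

section Fintype

variable [Fintype A]

theorem sat_diaAll (φ : Formula A) (x : F.carrier) :
    F.Sat θ (diaAll φ) x ↔ ∃ y, F.unionRel x y ∧ F.Sat θ φ y := by
  simp only [diaAll, sat_disj, List.mem_map, Finset.mem_toList, Finset.mem_univ, true_and,
    exists_exists_eq_and, sat_dia, unionRel]
  constructor
  · rintro ⟨a, y, h, h'⟩; exact ⟨y, ⟨a, h⟩, h'⟩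
  · rintro ⟨y, ⟨a, h⟩, h'⟩; exact ⟨a, y, h, h'⟩

theorem sat_diaIter (i : ℕ) (φ : Formula A) (x : F.carrier) :
    F.Sat θ (diaIter i φ) x ↔ ∃ y, F.steps i x y ∧ F.Sat θ φ y := by
  induction i generalizing x with
  | zero => simp [diaIter, steps]
  | succ i ih =>
    simp only [diaIter, sat_diaAll, ih, steps]
    constructor
    · rintro ⟨y, h, z, h', h''⟩; exact ⟨z, ⟨y, h, h'⟩, h''⟩
    · rintro ⟨z, ⟨y, h, h'⟩, h''⟩; exact ⟨y, h, z, h', h''⟩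

theorem sat_diaLe (m : ℕ) (φ : Formula A) (x : F.carrier) :
    F.Sat θ (diaLe m φ) x ↔ ∃ i ≤ m, ∃ y, F.steps i x y ∧ F.Sat θ φ y := by
  simp [diaLe, sat_disj, sat_diaIter]

end Fintype

/-- The frame over another alphabet obtained by renaming modalities. -/
def comap {B : Type u} (g : B → A) : KripkeFrame B where
  carrier := F.carrier
  rel b := F.rel (g b)

theorem sat_mapModality {B : Type u} (g : B → A) (φ : Formula B) (x : F.carrier) :
    F.Sat θ (mapModality g φ) x ↔ (F.comap g).Sat θ φ x := by
  induction φ generalizing x with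
  | var n => rfl
  | bot => rfl
  | imp φ ψ h₁ h₂ => exact imp_congr (h₁ x) (h₂ x)
  | dia a φ h => exact exists_congr fun y => and_congr_right fun _ => h y

theorem steps_comap {B : Type u} {g : B → A} (hg : g.Surjective) (i : ℕ) (x y : F.carrier) :
    (F.comap g).steps i x y ↔ F.steps i x y := by
  induction i generalizing x with
  | zero => rfl
  | succ i ih =>
    refine exists_congr fun z => and_congr ?_ (ih z)
    exact ⟨fun ⟨b, h⟩ => ⟨g b, h⟩, fun ⟨a, h⟩ => (hg a).imp fun b hb => by subst hb; exact h⟩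

/-- Renaming a disjunction over `B` need not give the chosen disjunction over `A` literally: order
and multiplicity can differ. Hence the comparison through truth in models. -/
theorem sat_mapModality_diaIter {B : Type u} [Fintype A] [Fintype B] {g : B → A}
    (hg : g.Surjective) {φ : Formula B} {ψ : Formula A}
    (h : ∀ x, F.Sat θ (mapModality g φ) x ↔ F.Sat θ ψ x) (i : ℕ) (x : F.carrier) :
    F.Sat θ (mapModality g (diaIter i φ)) x ↔ F.Sat θ (diaIter i ψ) x := by
  refine (F.sat_mapModality θ g _ x).trans (((F.comap g).sat_diaIter θ i φ x).trans
    (Iff.trans ?_ (F.sat_diaIter θ i ψ x).symm))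
  exact exists_congr fun y => and_congr (F.steps_comap hg i x y)
    ((F.sat_mapModality θ g φ y).symm.trans (h y))

theorem sat_mapModality_diaLe {B : Type u} [Fintype A] [Fintype B] {g : B → A}
    (hg : g.Surjective) {φ : Formula B} {ψ : Formula A}
    (h : ∀ x, F.Sat θ (mapModality g φ) x ↔ F.Sat θ ψ x) (m : ℕ) (x : F.carrier) :
    F.Sat θ (mapModality g (diaLe m φ)) x ↔ F.Sat θ (diaLe m ψ) x := by
  refine (F.sat_mapModality θ g _ x).trans (((F.comap g).sat_diaLe θ m φ x).trans
    (Iff.trans ?_ (F.sat_diaLe θ m ψ x).symm))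
  exact exists_congr fun i => and_congr_right fun _ => exists_congr fun y =>
    and_congr (F.steps_comap hg i x y) ((F.sat_mapModality θ g φ y).symm.trans (h y))

theorem sat_mapModality_transFormula {B : Type u} [Fintype A] [Fintype B] {g : B → A}
    (hg : g.Surjective) (m : ℕ) (x : F.carrier) :
    F.Sat θ (mapModality g (transFormula B m)) x ↔ F.Sat θ (transFormula A m) x :=
  imp_congr (F.sat_mapModality_diaIter θ hg (fun _ => Iff.rfl) _ x)
    (F.sat_mapModality_diaLe θ hg (fun _ => Iff.rfl) _ x)

theorem sat_mapModality_heightFormula {B : Type u} [Fintype A] [Fintype B] {g : B → A}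
    (hg : g.Surjective) (m h : ℕ) (x : F.carrier) :
    F.Sat θ (mapModality g (heightFormula B m h)) x ↔ F.Sat θ (heightFormula A m h) x := by
  induction h generalizing x with
  | zero => rfl
  | succ h ih =>
    refine imp_congr Iff.rfl (not_congr (F.sat_mapModality_diaLe θ hg (fun y => ?_) m x))
    refine not_congr (imp_congr (not_congr ?_) (ih y))
    exact F.sat_mapModality_diaLe θ hg (fun _ => Iff.rfl) m y

/-- Truth is preserved under isomorphic embeddings onto generated subframes. -/
theorem sat_image_iff {F G : KripkeFrame A} {e : F.carrier → G.carrier} (he : e.Injective)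
    (hrel : ∀ a x y, F.rel a x y ↔ G.rel a (e x) (e y))
    (hup : ∀ a x y, G.rel a (e x) y → ∃ z, e z = y) (θ : ℕ → Set F.carrier)
    (φ : Formula A) (x : F.carrier) :
    G.Sat (fun n => e '' θ n) φ (e x) ↔ F.Sat θ φ x := by
  induction φ generalizing x with
  | var n => exact he.mem_set_image
  | bot => rfl
  | imp φ ψ h₁ h₂ => exact imp_congr (h₁ x) (h₂ x)
  | dia a φ h =>
    constructor
    · rintro ⟨y, hy, h'⟩
      obtain ⟨z, rfl⟩ := hup a x y hy
      exact ⟨z, (hrel a x z).2 hy, (h z).1 h'⟩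
    · rintro ⟨z, hz, h'⟩
      exact ⟨e z, (hrel a x z).1 hz, (h z).2 h'⟩

end KripkeFrame

/-! ### Maximal consistent sets -/

/-- Truth assignments respecting the Boolean connectives. -/
structure IsBoolean (v : Formula A → Prop) : Prop where
  bot : ¬ v bot
  imp : ∀ φ ψ, v (imp φ ψ) ↔ (v φ → v ψ)

namespace IsBoolean

variable {v : Formula A → Prop} (hv : IsBoolean v)
include hv

theorem neg (φ : Formula A) : v (neg φ) ↔ ¬ v φ := by simp [Formula.neg, hv.imp, hv.bot]

theorem or (φ ψ : Formula A) : v (or φ ψ) ↔ v φ ∨ v ψ := by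
  simp only [Formula.or, hv.imp, hv.neg]; tauto

theorem and (φ ψ : Formula A) : v (and φ ψ) ↔ v φ ∧ v ψ := by
  simp only [Formula.and, hv.imp, hv.neg]; tauto

theorem conj (l : List (Formula A)) : v (conj l) ↔ ∀ φ ∈ l, v φ := by
  induction l with
  | nil => simp [Formula.conj, hv.neg, hv.bot]
  | cons φ l ih => simp [Formula.conj, hv.and, ih]

end IsBoolean

namespace IsNormalLogic

variable {L : Set (Formula A)} (hL : IsNormalLogic L)
include hL

theorem mem_of_forall {φ : Formula A} (h : ∀ v, IsBoolean v → v φ) : φ ∈ L :=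
  hL.tautology φ fun v hb hi => h v ⟨hb, hi⟩

theorem mem_of_mem {φ ψ : Formula A} (hφ : φ ∈ L) (h : ∀ v, IsBoolean v → v φ → v ψ) : ψ ∈ L :=
  hL.modusPonens φ ψ (hL.mem_of_forall fun v hv => (hv.imp _ _).2 (h v hv)) hφ

theorem mem_of_mem_of_mem {φ ψ χ : Formula A} (hφ : φ ∈ L) (hψ : ψ ∈ L)
    (h : ∀ v, IsBoolean v → v φ → v ψ → v χ) : χ ∈ L :=
  hL.modusPonens ψ χ (hL.mem_of_mem hφ fun v hv h' => (hv.imp _ _).2 (h v hv h')) hψ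

theorem dia_or_mem (a : A) (φ ψ : Formula A) :
    imp (dia a (or φ ψ)) (or (dia a φ) (dia a ψ)) ∈ L :=
  hL.substitution (fun n => if n = 0 then φ else ψ) _ (hL.dia_or a)

end IsNormalLogic

/-- `φ` is derivable in `L` from finitely many members of `Γ`. -/
def Derives (L Γ : Set (Formula A)) (φ : Formula A) : Prop :=
  ∃ l : List (Formula A), (∀ ψ ∈ l, ψ ∈ Γ) ∧ imp (conj l) φ ∈ L

theorem isConsistent_iff {L Γ : Set (Formula A)} : IsConsistent L Γ ↔ ¬ Derives L Γ bot := by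
  simp only [IsConsistent, Derives, not_exists, not_and]; rfl

namespace Derives

variable {L Γ : Set (Formula A)} {φ ψ : Formula A}

theorem of_mem (hL : IsNormalLogic L) (h : φ ∈ Γ) : Derives L Γ φ :=
  ⟨[φ], by simpa using h, hL.mem_of_forall fun v hv => by simp [hv.imp, hv.conj]⟩

theorem of_mem_logic (hL : IsNormalLogic L) (h : φ ∈ L) : Derives L Γ φ :=
  ⟨[], by simp, hL.mem_of_mem h fun v hv => by simp +contextual [hv.imp]⟩

theorem mp (hL : IsNormalLogic L) (h : Derives L Γ (imp φ ψ)) (h' : Derives L Γ φ) :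
    Derives L Γ ψ := by
  obtain ⟨l, hl, h⟩ := h
  obtain ⟨l', hl', h'⟩ := h'
  refine ⟨l ++ l', ?_, hL.mem_of_mem_of_mem h h' fun v hv => ?_⟩
  · intro χ hχ
    exact (List.mem_append.1 hχ).elim (hl χ) (hl' χ)
  · simp only [hv.imp, hv.conj, List.mem_append]
    exact fun h₁ h₂ h₃ => h₁ (fun χ hχ => h₃ χ (.inl hχ)) (h₂ fun χ hχ => h₃ χ (.inr hχ))

theorem deduction (hL : IsNormalLogic L) (h : Derives L (insert φ Γ) ψ) :
    Derives L Γ (imp φ ψ) := by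
  classical
  obtain ⟨l, hl, h⟩ := h
  refine ⟨l.filter (· ≠ φ), ?_, hL.mem_of_mem h fun v hv => ?_⟩
  · intro χ hχ
    obtain ⟨h₁, h₂⟩ := List.mem_filter.1 hχ
    exact (hl χ h₁).resolve_left (by simpa using h₂)
  · simp only [hv.imp, hv.conj, List.mem_filter, decide_eq_true_eq]
    intro h₁ h₂ h₃
    refine h₁ fun χ hχ => ?_
    by_cases hc : χ = φ
    · exact hc ▸ h₃
    · exact h₂ χ ⟨hχ, hc⟩

end Derives

theorem exists_maximal_consistent {L Γ : Set (Formula A)} (h : IsConsistent L Γ) :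
    ∃ Δ, Γ ⊆ Δ ∧ Maximal (IsConsistent L) Δ := by
  refine zorn_subset_nonempty {Δ | IsConsistent L Δ} (fun c hc hchain hne => ?_) Γ h
  refine ⟨⋃₀ c, fun l hl => ?_, fun s hs => Set.subset_sUnion_of_mem hs⟩
  have key : ∀ l : List (Formula A), (∀ φ ∈ l, φ ∈ ⋃₀ c) → ∃ s ∈ c, ∀ φ ∈ l, φ ∈ s := by
    intro l
    induction l with
    | nil => exact fun _ => hne.imp fun s hs => ⟨hs, by simp⟩
    | cons φ l ih =>
      intro hl
      obtain ⟨s, hs, h₁⟩ := ih fun ψ hψ => hl ψ (List.mem_cons_of_mem _ hψ)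
      obtain ⟨t, ht, h₂⟩ := hl φ List.mem_cons_self
      rcases hchain.total hs ht with hst | hts
      · exact ⟨t, ht, by simpa [h₂] using fun ψ hψ => hst (h₁ ψ hψ)⟩
      · exact ⟨s, hs, by simpa [hts h₂] using h₁⟩
  obtain ⟨s, hs, h'⟩ := key l hl
  exact hc hs l h'

section Maximal

variable {L Γ : Set (Formula A)}

theorem mem_of_derives (hL : IsNormalLogic L) (hΓ : Maximal (IsConsistent L) Γ) {φ : Formula A}
    (h : Derives L Γ φ) : φ ∈ Γ := by
  refine hΓ.2 (y := insert φ Γ) ?_ (Set.subset_insert _ _) (Set.mem_insert _ _)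
  exact isConsistent_iff.2 fun h' => isConsistent_iff.1 hΓ.1 ((h'.deduction hL).mp hL h)

theorem mem_of_mem_logic (hL : IsNormalLogic L) (hΓ : Maximal (IsConsistent L) Γ)
    {φ : Formula A} (h : φ ∈ L) : φ ∈ Γ :=
  mem_of_derives hL hΓ (.of_mem_logic hL h)

theorem mem_of_imp_mem (hL : IsNormalLogic L) (hΓ : Maximal (IsConsistent L) Γ)
    {φ ψ : Formula A} (h : imp φ ψ ∈ L) (h' : φ ∈ Γ) : ψ ∈ Γ :=
  mem_of_derives hL hΓ (.mp hL (.of_mem_logic hL h) (.of_mem hL h'))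

theorem isBoolean_mem (hL : IsNormalLogic L) (hΓ : Maximal (IsConsistent L) Γ) :
    IsBoolean (· ∈ Γ) := by
  refine ⟨fun h => isConsistent_iff.1 hΓ.1 (.of_mem hL h), fun φ ψ => ⟨fun h h' => ?_, fun h => ?_⟩⟩
  · exact mem_of_derives hL hΓ (.mp hL (.of_mem hL h) (.of_mem hL h'))
  · by_cases hφ : φ ∈ Γ
    · refine mem_of_imp_mem hL hΓ (hL.mem_of_forall fun v hv => ?_) (h hφ)
      simp +contextual [hv.imp]
    · have hd : Derives L (insert φ Γ) bot := by
        by_contra hc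
        exact hφ (hΓ.2 (isConsistent_iff.2 hc) (Set.subset_insert _ _) (Set.mem_insert _ _))
      refine mem_of_imp_mem hL hΓ (hL.mem_of_forall fun v hv => ?_)
        (mem_of_derives hL hΓ (hd.deduction hL))
      simp only [hv.imp, hv.bot]
      tauto

/-- `S` together with all `¬ψ`, `◇ψ ∉ Γ`, is consistent: directedness compresses finitely many
members of `S` into one `φ`, additivity of `◇` compresses the `ψ`'s into one, and `φ → ψ ∈ L` would
put `◇ψ` into `Γ`. A singleton `S` gives the truth lemma; `steps_of_forall` needs directed sets. -/
theorem exists_rel_of_directed (hL : IsNormalLogic L) (hΓ : Maximal (IsConsistent L) Γ) (a : A)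
    {S : Set (Formula A)} (hne : S.Nonempty)
    (hdir : ∀ φ ∈ S, ∀ ψ ∈ S, ∃ χ ∈ S, imp χ φ ∈ L ∧ imp χ ψ ∈ L)
    (hS : ∀ φ ∈ S, dia a φ ∈ Γ) :
    ∃ Δ, Maximal (IsConsistent L) Δ ∧ S ⊆ Δ ∧ ∀ φ ∈ Δ, dia a φ ∈ Γ := by
  have hB := isBoolean_mem hL hΓ
  have key : ∀ l : List (Formula A), (∀ φ ∈ l, φ ∈ S ∪ {χ | ∃ ψ, χ = neg ψ ∧ dia a ψ ∉ Γ}) →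
      ∃ φ ∈ S, ∃ ψ, dia a ψ ∉ Γ ∧ imp φ (or ψ (conj l)) ∈ L := by
    intro l
    induction l with
    | nil =>
      refine fun _ => hne.imp fun φ hφ => ⟨hφ, bot, ?_, hL.mem_of_forall fun v hv => ?_⟩
      · exact (hB.neg _).1 (mem_of_mem_logic hL hΓ (hL.dia_bot a))
      · simp [hv.imp, hv.or, hv.conj]
    | cons χ l ih =>
      intro hl
      obtain ⟨φ, hφ, ψ, hψ, h⟩ := ih fun ψ hψ => hl ψ (List.mem_cons_of_mem _ hψ)
      rcases hl χ List.mem_cons_self with hχ | ⟨ψ', rfl, hψ'⟩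
      · obtain ⟨ξ, hξ, h₁, h₂⟩ := hdir φ hφ χ hχ
        refine ⟨ξ, hξ, ψ, hψ, hL.mem_of_mem_of_mem
          (hL.mem_of_mem_of_mem h h₁ (χ := imp ξ (or ψ (conj l))) fun v hv => ?_) h₂
          fun v hv => ?_⟩
        · simp only [hv.imp]; tauto
        · simp only [hv.imp, hv.or, hv.conj, List.forall_mem_cons]; tauto
      · refine ⟨φ, hφ, or ψ ψ', fun hc => ?_, hL.mem_of_mem h fun v hv => ?_⟩
        · exact ((hB.or _ _).1 (mem_of_imp_mem hL hΓ (hL.dia_or_mem a ψ ψ') hc)).elim hψ hψ'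
        · simp only [hv.imp, hv.or, hv.conj, List.forall_mem_cons, hv.neg]; tauto
  have hcons : IsConsistent L (S ∪ {χ | ∃ ψ, χ = neg ψ ∧ dia a ψ ∉ Γ}) := by
    intro l hl hmem
    obtain ⟨φ, hφ, ψ, hψ, h⟩ := key l hl
    refine hψ (mem_of_imp_mem hL hΓ (hL.monotonicity a φ ψ ?_) (hS φ hφ))
    refine hL.mem_of_mem_of_mem h hmem fun v hv => ?_
    simp only [hv.imp, hv.or, hv.neg]; tauto
  obtain ⟨Δ, hsub, hΔ⟩ := exists_maximal_consistent hcons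
  refine ⟨Δ, hΔ, fun φ hφ => hsub (.inl hφ), fun φ hφ => ?_⟩
  by_contra hc
  exact ((isBoolean_mem hL hΔ).neg φ).1 (hsub (.inr ⟨φ, rfl, hc⟩)) hφ

end Maximal

/-! ### The canonical model -/

/-- The canonical valuation. -/
def canonicalVal (L : Set (Formula A)) (n : ℕ) : Set (canonicalFrame L).carrier :=
  {Γ | var n ∈ Γ.1}

/-- Truth in the canonical model. -/
def CSat (L : Set (Formula A)) (φ : Formula A) (x : (canonicalFrame L).carrier) : Prop :=
  (canonicalFrame L).Sat (canonicalVal L) φ x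

section Canonical

variable {L : Set (Formula A)} (hL : IsNormalLogic L)
include hL

theorem csat_iff_mem (φ : Formula A) (x : (canonicalFrame L).carrier) :
    CSat L φ x ↔ φ ∈ x.1 := by
  induction φ generalizing x with
  | var n => rfl
  | bot => exact iff_of_false id (isBoolean_mem hL x.2).bot
  | imp φ ψ h₁ h₂ =>
    exact (imp_congr (h₁ x) (h₂ x)).trans ((isBoolean_mem hL x.2).imp φ ψ).symm
  | dia a φ h =>
    constructor
    · rintro ⟨y, hy, h'⟩
      exact hy φ ((h y).1 h')
    · intro h'
      obtain ⟨Δ, hΔ, hS, hR⟩ := exists_rel_of_directed hL x.2 a (Set.singleton_nonempty φ)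
        (fun ψ hψ χ hχ => ⟨φ, rfl, by
          rw [show ψ = φ from hψ, show χ = φ from hχ, and_self]
          exact hL.mem_of_forall fun v hv => by simp [hv.imp]⟩)
        (fun ψ hψ => by rw [show ψ = φ from hψ]; exact h')
      exact ⟨⟨Δ, hΔ⟩, hR, (h ⟨Δ, hΔ⟩).2 (hS rfl)⟩

theorem mem_iff_csat (φ : Formula A) : φ ∈ L ↔ ∀ x, CSat L φ x := by
  refine ⟨fun h x => (csat_iff_mem hL φ x).2 (mem_of_mem_logic hL x.2 h), fun h => ?_⟩
  by_contra hφ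
  have hc : IsConsistent L {neg φ} := by
    refine isConsistent_iff.2 ?_
    rintro ⟨l, hl, h'⟩
    refine hφ (hL.mem_of_mem h' fun v hv => ?_)
    simp only [hv.imp, hv.conj, hv.bot]
    intro h₁
    by_contra h₂
    exact h₁ fun ψ hψ => by rw [hl ψ hψ]; exact (hv.neg φ).2 h₂
  obtain ⟨Δ, hsub, hΔ⟩ := exists_maximal_consistent hc
  exact ((isBoolean_mem hL hΔ).neg φ).1 (hsub rfl) ((csat_iff_mem hL φ ⟨Δ, hΔ⟩).1 (h ⟨Δ, hΔ⟩))

theorem iff_mem_iff (φ ψ : Formula A) : iff φ ψ ∈ L ↔ ∀ x, CSat L φ x ↔ CSat L ψ x := by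
  rw [mem_iff_csat hL]
  exact forall_congr' fun x => KripkeFrame.sat_iff _ _ φ ψ x

end Canonical

end PolyModal
namespace PolyModal

open Formula

variable {A : Type u}

/-! ### One-finite logics have finite height -/

namespace Formula

theorem subst_disj (σ : ℕ → Formula A) (l : List (Formula A)) :
    subst σ (disj l) = disj (l.map (subst σ)) := by
  induction l with
  | nil => rfl
  | cons φ l ih => simp [disj, Formula.or, neg, subst, ih]

theorem IsKFormula.disj {k : ℕ} {l : List (Formula A)} (h : ∀ φ ∈ l, φ.IsKFormula k) :
    (disj l).IsKFormula k := by
  induction l with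
  | nil => trivial
  | cons φ l ih =>
    exact ⟨⟨h φ List.mem_cons_self, trivial⟩, ih fun ψ hψ => h ψ (List.mem_cons_of_mem _ hψ)⟩

variable [Fintype A]

theorem subst_diaIter (σ : ℕ → Formula A) (i : ℕ) (φ : Formula A) :
    subst σ (diaIter i φ) = diaIter i (subst σ φ) := by
  induction i with
  | zero => rfl
  | succ i ih => simp [diaIter, diaAll, subst_disj, subst, ← ih, Function.comp_def]

theorem subst_diaLe (σ : ℕ → Formula A) (m : ℕ) (φ : Formula A) :
    subst σ (diaLe m φ) = diaLe m (subst σ φ) := by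
  simp [diaLe, subst_disj, subst_diaIter, Function.comp_def]

theorem IsKFormula.diaIter {k : ℕ} {φ : Formula A} (h : φ.IsKFormula k) (i : ℕ) :
    (diaIter i φ).IsKFormula k := by
  induction i with
  | zero => exact h
  | succ i ih =>
    refine .disj fun ψ hψ => ?_
    obtain ⟨a, -, rfl⟩ := List.mem_map.1 hψ
    exact ih

theorem IsKFormula.diaLe {k : ℕ} {φ : Formula A} (h : φ.IsKFormula k) (m : ℕ) :
    (diaLe m φ).IsKFormula k :=
  .disj fun ψ hψ => by
    obtain ⟨a, -, rfl⟩ := List.mem_map.1 hψ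
    exact h.diaIter a

end Formula

theorem KFinite.exists_lt_iff_mem {L : Set (Formula A)} (hL : IsNormalLogic L) {k : ℕ}
    (h : KFinite k L) {f : ℕ → Formula A} (hf : ∀ n, (f n).IsKFormula k) :
    ∃ i j, i < j ∧ iff (f i) (f j) ∈ L := by
  obtain ⟨S, hS, h⟩ := h
  choose g hgS _ hg using fun n => h (f n) (hf n)
  have := hS.to_subtype
  obtain ⟨i, j, hij, he⟩ := Finite.exists_ne_map_eq_of_infinite fun n => (⟨g n, hgS n⟩ : S)
  have he : g i = g j := congrArg Subtype.val he
  have key : ∀ i j, g i = g j → iff (f i) (f j) ∈ L := fun i j he => by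
    have h₁ := (iff_mem_iff hL _ _).1 (hg i)
    have h₂ := (iff_mem_iff hL _ _).1 (hg j)
    exact (iff_mem_iff hL _ _).2 fun x => (h₁ x).trans (he ▸ (h₂ x).symm)
  rcases lt_or_gt_of_ne hij with h' | h'
  · exact ⟨i, j, h', key i j he⟩
  · exact ⟨j, i, h', key j i he.symm⟩

variable [Fintype A] {L : Set (Formula A)}

/-- If `◇^{≤ i} p` and `◇^{≤ j} p` are equivalent with `i < j`, then `◇^{i+1} p`, a disjunct of the
latter, implies the former. -/
theorem exists_transFormula_mem (hL : IsNormalLogic L) (h : KFinite 1 L) :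
    ∃ m, transFormula A m ∈ L := by
  obtain ⟨i, j, hij, h'⟩ := h.exists_lt_iff_mem hL (f := fun n => diaLe n (var 0))
    fun n => IsKFormula.diaLe (φ := var 0) Nat.zero_lt_one n
  refine ⟨i, (mem_iff_csat hL _).2 fun x hx => ((iff_mem_iff hL _ _).1 h' x).2 ?_⟩
  obtain ⟨y, hy, h₁⟩ := (KripkeFrame.sat_diaIter _ _ _ _ _).1 hx
  exact (KripkeFrame.sat_diaLe _ _ _ _ _).2 ⟨i + 1, hij, y, hy, h₁⟩

/-- Paths are shortened by substitution instances of the transitivity formula. `L` need not be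
canonical, so this is available for formulas only, not for arbitrary sets of points. -/
theorem csat_diaLe (hL : IsNormalLogic L) {m : ℕ} (ht : transFormula A m ∈ L) (φ : Formula A)
    (x : (canonicalFrame L).carrier) :
    CSat L (diaLe m φ) x ↔ ∃ y, (canonicalFrame L).reach x y ∧ CSat L φ y := by
  constructor
  · intro h
    obtain ⟨i, -, y, hy, h'⟩ := (KripkeFrame.sat_diaLe _ _ _ _ _).1 h
    exact ⟨y, KripkeFrame.reach_of_steps _ hy, h'⟩
  · rintro ⟨y, hy, h⟩
    induction hy using Relation.ReflTransGen.head_induction_on with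
    | refl => exact (KripkeFrame.sat_diaLe _ _ _ _ _).2 ⟨0, Nat.zero_le _, y, rfl, h⟩
    | @head x z hxz hzy ih =>
      obtain ⟨i, hi, y', hy', h'⟩ := (KripkeFrame.sat_diaLe _ _ _ _ _).1 ih
      rcases hi.lt_or_eq with hlt | rfl
      · exact (KripkeFrame.sat_diaLe _ _ _ _ _).2 ⟨i + 1, hlt, y', ⟨z, hxz, hy'⟩, h'⟩
      · have hs := hL.substitution (fun _ => φ) _ ht
        simp only [transFormula, subst, subst_diaIter, subst_diaLe] at hs
        exact (mem_iff_csat hL _).1 hs x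
          ((KripkeFrame.sat_diaIter _ _ _ _ _).2 ⟨y', ⟨z, hxz, hy'⟩, h'⟩)

theorem csat_boxLe (hL : IsNormalLogic L) {m : ℕ} (ht : transFormula A m ∈ L) (φ : Formula A)
    (x : (canonicalFrame L).carrier) :
    CSat L (boxLe m φ) x ↔ ∀ y, (canonicalFrame L).reach x y → CSat L φ y := by
  refine (not_congr (csat_diaLe hL ht (neg φ) x)).trans ?_
  push Not
  exact forall_congr' fun y => imp_congr_right fun _ => not_not

/-! ### Ranks and alternation formulas -/

/-- The largest `i ≤ h` such that `◇^{≤ m} p_i` holds at the point, with value zero if there is no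
such positive `i`. -/
noncomputable def rank (L : Set (Formula A)) (m : ℕ) : ℕ → (canonicalFrame L).carrier → ℕ
  | 0, _ => 0
  | h + 1, x => open Classical in if CSat L (diaLe m (var (h + 1))) x then h + 1 else rank L m h x

/-- The formula saying that the rank is odd. -/
noncomputable def oddRank (A : Type u) [Fintype A] (m : ℕ) : ℕ → Formula A
  | 0 => bot
  | h + 1 => or (and (diaLe m (var (h + 1))) (if Even h then neg bot else bot))
      (and (neg (diaLe m (var (h + 1)))) (oddRank A m h))

/-- There is an ascending path of `n` alternations of the truth value of `p_0`, ending in truth. -/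
noncomputable def alternation (A : Type u) [Fintype A] (m : ℕ) : ℕ → Formula A
  | 0 => neg bot
  | n + 1 => diaLe m (and (if Even n then var 0 else neg (var 0)) (alternation A m n))

theorem isKFormula_alternation (m n : ℕ) : (alternation A m n).IsKFormula 1 := by
  induction n with
  | zero => exact ⟨trivial, trivial⟩
  | succ n ih =>
    refine IsKFormula.diaLe ?_ m
    split_ifs <;> simp [Formula.and, neg, IsKFormula, ih]

theorem rank_le (m h : ℕ) (x : (canonicalFrame L).carrier) : rank L m h x ≤ h := by
  induction h with
  | zero => exact le_rfl
  | succ h ih =>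
    rw [rank]
    split_ifs
    · exact le_rfl
    · omega

theorem csat_diaLe_of_reach (hL : IsNormalLogic L) {m : ℕ} (ht : transFormula A m ∈ L)
    {φ : Formula A} {x y : (canonicalFrame L).carrier} (hxy : (canonicalFrame L).reach x y)
    (h : CSat L (diaLe m φ) y) : CSat L (diaLe m φ) x := by
  obtain ⟨z, hz, h'⟩ := (csat_diaLe hL ht φ y).1 h
  exact (csat_diaLe hL ht φ x).2 ⟨z, Relation.ReflTransGen.trans hxy hz, h'⟩

theorem rank_le_of_reach (hL : IsNormalLogic L) {m : ℕ} (ht : transFormula A m ∈ L) (h : ℕ)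
    {x y : (canonicalFrame L).carrier} (hxy : (canonicalFrame L).reach x y) :
    rank L m h y ≤ rank L m h x := by
  induction h with
  | zero => exact le_rfl
  | succ h ih =>
    by_cases hx : CSat L (diaLe m (var (h + 1))) x
    · rw [rank, rank, if_pos hx]
      split_ifs
      · exact le_rfl
      · exact (rank_le m h y).trans (Nat.le_succ h)
    · rwa [rank, rank, if_neg hx,
        if_neg fun hy => hx (csat_diaLe_of_reach hL ht hxy hy)]

theorem csat_oddRank (m h : ℕ) (x : (canonicalFrame L).carrier) :
    CSat L (oddRank A m h) x ↔ Odd (rank L m h x) := by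
  induction h with
  | zero => simp [oddRank, rank, CSat]
  | succ h ih =>
    have : CSat L (if Even h then neg bot else bot) x ↔ Even h := by
      split_ifs with he <;> simp [CSat, he]
    simp only [CSat] at this ih
    simp only [oddRank, rank, CSat, KripkeFrame.sat_or, KripkeFrame.sat_and, this,
      KripkeFrame.sat_neg, ih]
    split_ifs with hq <;> simp [hq, Nat.odd_add_one]

theorem rank_eq {m n h : ℕ} (hn : n ≤ h) {x : (canonicalFrame L).carrier}
    (h₀ : 0 < n → CSat L (diaLe m (var n)) x)
    (h₁ : ∀ j, n < j → j ≤ h → ¬ CSat L (diaLe m (var j)) x) : rank L m h x = n := by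
  induction h with
  | zero => rw [rank]; omega
  | succ h ih =>
    rcases hn.lt_or_eq with hlt | rfl
    · rw [rank, if_neg (h₁ _ hlt le_rfl)]
      exact ih (Nat.le_of_lt_succ hlt) fun j hj hj' => h₁ j hj (hj'.trans (Nat.le_succ h))
    · rw [rank, if_pos (h₀ (Nat.succ_pos _))]

/-- After substitution, the literal at level `n` of `alternation` says that the rank has the parity
of `n + 1`. -/
theorem csat_literal (m h n : ℕ) (x : (canonicalFrame L).carrier) :
    CSat L (subst (fun _ => oddRank A m h) (if Even n then var 0 else neg (var 0))) x ↔
      (Odd (rank L m h x) ↔ Even n) := by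
  by_cases hn : Even n
  · rw [if_pos hn]
    exact (csat_oddRank m h x).trans (by simp [hn])
  · rw [if_neg hn]
    exact (not_congr (csat_oddRank m h x)).trans (by simp [hn])

/-- The point refutes the formula of height `n`, and all formulas `◇^{≤ m} p_j`, `n < j ≤ h`. -/
def IsChainPoint (L : Set (Formula A)) (m h n : ℕ) (x : (canonicalFrame L).carrier) : Prop :=
  ¬ CSat L (heightFormula A m n) x ∧ ∀ j, n < j → j ≤ h → ¬ CSat L (diaLe m (var j)) x

namespace IsChainPoint

variable (hL : IsNormalLogic L) {m : ℕ} (ht : transFormula A m ∈ L)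
include hL ht

/-- For `n > 0`, refuting the height formula makes `p_n` true at the point itself. -/
theorem rank_eq {h n : ℕ} {x : (canonicalFrame L).carrier}
    (hx : IsChainPoint L m h n x) (hn : n ≤ h) : rank L m h x = n := by
  refine PolyModal.rank_eq hn (fun h₀ => ?_) hx.2
  obtain ⟨n, rfl⟩ := Nat.exists_eq_succ_of_ne_zero h₀.ne'
  exact (csat_diaLe hL ht _ x).2 ⟨x, .refl, by_contra fun hc => hx.1 fun h => absurd h hc⟩

theorem exists_reach_succ {h n : ℕ} {x : (canonicalFrame L).carrier}
    (hx : IsChainPoint L m h (n + 1) x) :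
    ∃ y, (canonicalFrame L).reach x y ∧ IsChainPoint L m h n y := by
  have h₁ : ¬ CSat L (boxLe m (or (diaLe m (var (n + 1))) (heightFormula A m n))) x :=
    fun hc => hx.1 fun _ => hc
  rw [csat_boxLe hL ht] at h₁
  push Not at h₁
  obtain ⟨y, hxy, h₂⟩ := h₁
  have h₂ := (not_congr (KripkeFrame.sat_or _ _ _ _ y)).1 h₂
  push Not at h₂
  refine ⟨y, hxy, h₂.2, fun j hj hj' hc => ?_⟩
  rcases (Nat.succ_le_of_lt hj).lt_or_eq with hlt | rfl
  · exact hx.2 j hlt hj' (csat_diaLe_of_reach hL ht hxy hc)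
  · exact h₂.1 hc

theorem exists_reach {h n k : ℕ} {x : (canonicalFrame L).carrier}
    (hx : IsChainPoint L m h n x) (hk : k ≤ n) :
    ∃ y, (canonicalFrame L).reach x y ∧ IsChainPoint L m h k y := by
  induction n generalizing x with
  | zero => exact ⟨x, .refl, by rwa [Nat.le_zero.1 hk]⟩
  | succ n ih =>
    rcases hk.lt_or_eq with hlt | rfl
    · obtain ⟨y, hxy, hy⟩ := hx.exists_reach_succ hL ht
      obtain ⟨z, hyz, hz⟩ := ih hy (Nat.le_of_lt_succ hlt)
      exact ⟨z, Relation.ReflTransGen.trans hxy hyz, hz⟩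
    · exact ⟨x, .refl, hx⟩

theorem csat_alternation {h n k : ℕ} {x : (canonicalFrame L).carrier}
    (hx : IsChainPoint L m h n x) (hk : k ≤ n) (hn : n ≤ h) :
    CSat L (subst (fun _ => oddRank A m h) (alternation A m k)) x := by
  induction k generalizing n x with
  | zero => exact id
  | succ k ih =>
    obtain ⟨y, hxy, hy⟩ := hx.exists_reach hL ht hk
    rw [alternation, subst_diaLe, csat_diaLe hL ht]
    refine ⟨y, hxy, (KripkeFrame.sat_and _ _ _ _ y).2
      ⟨(csat_literal m h k y).2 ?_, ih hy (Nat.le_succ k) (hk.trans hn)⟩⟩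
    rw [hy.rank_eq hL ht (hk.trans hn), Nat.odd_add_one, Nat.not_odd_iff_even]

end IsChainPoint

/-- The witness `y` has rank at least `k` and of the parity of `k + 1`, hence at least `k + 1`;
ranks do not increase along paths. -/
theorem le_rank_of_csat_alternation (hL : IsNormalLogic L) {m : ℕ} (ht : transFormula A m ∈ L)
    (h k : ℕ) {x : (canonicalFrame L).carrier}
    (hx : CSat L (subst (fun _ => oddRank A m h) (alternation A m k)) x) :
    k ≤ rank L m h x := by
  induction k generalizing x with
  | zero => exact Nat.zero_le _
  | succ k ih =>
    rw [alternation, subst_diaLe, csat_diaLe hL ht] at hx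
    obtain ⟨y, hxy, hy⟩ := hx
    obtain ⟨h₁, h₂⟩ := (KripkeFrame.sat_and _ _ _ _ y).1 hy
    have h₁ := (csat_literal m h k y).1 h₁
    have h₂ := ih h₂
    have h₃ := rank_le_of_reach hL ht h hxy
    rcases h₂.lt_or_eq with hlt | he
    · omega
    · rw [← he, ← Nat.not_even_iff_odd] at h₁
      tauto

theorem exists_heightFormula_mem (hL : IsNormalLogic L) {m : ℕ} (ht : transFormula A m ∈ L)
    (h : KFinite 1 L) : ∃ n, heightFormula A m n ∈ L := by
  obtain ⟨i, j, hij, h'⟩ := h.exists_lt_iff_mem hL fun n => isKFormula_alternation (A := A) m n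
  refine ⟨j, ?_⟩
  by_contra hj
  rw [mem_iff_csat hL] at hj
  push Not at hj
  obtain ⟨x, hx⟩ := hj
  have hx : IsChainPoint L m j j x := ⟨hx, fun k hk hk' => absurd hk hk'.not_gt⟩
  obtain ⟨y, -, hy⟩ := hx.exists_reach hL ht hij.le
  have h₁ := (iff_mem_iff hL _ _).1 (hL.substitution (fun _ => oddRank A m j) _ h') y
  have h₂ := le_rank_of_csat_alternation hL ht j j
    (h₁.1 (hy.csat_alternation hL ht le_rfl hij.le))
  rw [hy.rank_eq hL ht hij.le] at h₂
  omega

theorem logicHeight_lt_top_of_kFinite (hL : IsNormalLogic L) (h : KFinite 1 L) :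
    logicHeight L < ⊤ := by
  classical
  have hex := exists_transFormula_mem hL h
  have hm : transIndex L = (Nat.find hex : ℕ) := by
    refine le_antisymm (sInf_le ⟨_, rfl, Nat.find_spec hex⟩) (le_sInf ?_)
    rintro _ ⟨m, rfl, hm⟩
    exact_mod_cast Nat.find_min' hex hm
  obtain ⟨n, hn⟩ := exists_heightFormula_mem hL (Nat.find_spec hex) h
  have hle : logicHeight L ≤ n := sInf_le ⟨_, n, hm, rfl, hn⟩
  exact hle.trans_lt (ENat.natCast_lt_top n)

theorem exists_mem_of_logicHeight_lt_top (h : logicHeight L < ⊤) :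
    ∃ m n, transFormula A m ∈ L ∧ heightFormula A m n ∈ L := by
  obtain ⟨_, ⟨m, n, hm, rfl, hn⟩, -⟩ := sInf_lt_iff.1 h
  have hlt : transIndex L < ⊤ := hm ▸ ENat.natCast_lt_top m
  obtain ⟨x, hx, -⟩ := sInf_lt_iff.1 hlt
  -- A finite transitivity index is attained, so both formulas are obtained for the same `m`.
  obtain ⟨m', h₁, h₂⟩ := csInf_mem (s := {x : ℕ∞ | ∃ m : ℕ, x = m ∧ transFormula A m ∈ L}) ⟨x, hx⟩
  have : m = m' := by exact_mod_cast hm.symm.trans h₁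
  exact ⟨m, n, this ▸ h₂, hn⟩

end PolyModal
namespace PolyModal

open Formula

variable {A : Type u}

/-! ### Tuned colorings -/

namespace KripkeFrame

/-- The points of depth at most `i`. -/
def depthSet (F : KripkeFrame A) : ℕ → Set F.carrier
  | 0 => ∅
  | i + 1 => {x | ∀ y, F.reach x y → F.reach y x ∨ y ∈ F.depthSet i}

theorem mem_depthSet_of_reach {F : KripkeFrame A} {i : ℕ} {x y : F.carrier}
    (hx : x ∈ F.depthSet i) (h : F.reach x y) : y ∈ F.depthSet i := by
  cases i with
  | zero => exact hx
  | succ i =>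
    intro z hz
    rcases hx z (Relation.ReflTransGen.trans h hz) with h' | h'
    · exact .inl (Relation.ReflTransGen.trans h' h)
    · exact .inr h'

/-- Finite colorings have tuned refinements, provided that finite partitions do. -/
theorem exists_tuned_coloring {G : KripkeFrame A} {f : ℕ → ℕ}
    (hf : ∀ P : Set (Set G.carrier), Setoid.IsPartition P → P.Finite →
      ∃ Q : Set (Set G.carrier), Setoid.IsPartition Q ∧ (∀ U ∈ Q, ∃ V ∈ P, U ⊆ V) ∧
        Q.Finite ∧ Q.ncard ≤ f P.ncard ∧ G.IsTuned Q)
    {T : Type*} [Finite T] (c : G.carrier → T) {N : ℕ} (hN : ∀ k ≤ Nat.card T, f k ≤ N) :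
    ∃ d : G.carrier → Fin N, (∀ x y, d x = d y → c x = c y) ∧
      ∀ a x x' y, G.rel a x y → d x = d x' → ∃ y', G.rel a x' y' ∧ d y' = d y := by
  have hsub : (Setoid.ker c).classes ⊆ (fun t => c ⁻¹' {t}) '' Set.univ := by
    rintro _ ⟨x, rfl⟩
    exact ⟨c x, trivial, rfl⟩
  have hfin : ((fun t => c ⁻¹' {t}) '' Set.univ).Finite := Set.toFinite _
  have hcard : (Setoid.ker c).classes.ncard ≤ Nat.card T := by
    refine (Set.ncard_le_ncard hsub hfin).trans ?_
    rw [← Set.ncard_univ]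
    exact Set.ncard_image_le
  obtain ⟨Q, hQ, href, hQfin, hQcard, htuned⟩ :=
    hf _ (Setoid.isPartition_classes (Setoid.ker c)) (hfin.subset hsub)
  have := hQfin.to_subtype
  choose blk hblk huniq using hQ.2
  have hle : Nat.card Q ≤ N := by
    rw [Nat.card_coe_set_eq]
    exact hQcard.trans (hN _ hcard)
  let e : Q → Fin N := fun U => Fin.castLE hle (Finite.equivFin Q U)
  have he : e.Injective := (Fin.castLE_injective hle).comp (Finite.equivFin Q).injective
  have hd : ∀ x y, e ⟨blk x, (hblk x).1⟩ = e ⟨blk y, (hblk y).1⟩ → blk x = blk y :=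
    fun x y h => congrArg Subtype.val (he h)
  refine ⟨fun x => e ⟨blk x, (hblk x).1⟩, fun x y h => ?_, fun a x x' y hxy h => ?_⟩
  · obtain ⟨_, ⟨z, rfl⟩, hz⟩ := href _ (hblk x).1
    have hx : c x = c z := hz (hblk x).2
    have hy : c y = c z := hz (hd x y h ▸ (hblk y).2)
    exact hx.trans hy.symm
  · obtain ⟨y', hy', h'⟩ := htuned a _ (hblk x).1 _ (hblk y).1
      ⟨x, (hblk x).2, y, (hblk y).2, hxy⟩ x' (hd x x' h ▸ (hblk x').2)
    refine ⟨y', h', ?_⟩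
    have : blk y' = blk y := (huniq y' _ ⟨(hblk y).1, hy'⟩).symm
    simp only [this]

/-- If the clusters of a frame are uniformly tunable, then every finite coloring has a finite
refinement that is tuned on the points of depth at most `i`. -/
theorem exists_tuned_coloring_depthSet [Finite A] (F : KripkeFrame A)
    (hF : UniformlyTunable (clusterFrames {F})) {T : Type*} [Finite T] (c : F.carrier → T)
    (i : ℕ) : ∃ (n : ℕ) (d : F.carrier → Fin n),
      (∀ x ∈ F.depthSet i, ∀ y ∈ F.depthSet i, d x = d y → c x = c y) ∧
      ∀ a, ∀ x ∈ F.depthSet i, ∀ x' ∈ F.depthSet i, ∀ y, F.rel a x y → d x = d x' →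
        ∃ y', F.rel a x' y' ∧ d y' = d y := by
  classical
  induction i with
  | zero =>
    exact ⟨1, fun _ => 0, fun x hx => hx.elim, fun a x hx => hx.elim⟩
  | succ i ih =>
    obtain ⟨n, d, hdc, hdt⟩ := ih
    obtain ⟨f, hf⟩ := hF
    let W := T × (A → Fin n → Prop)
    have : Finite W := inferInstanceAs (Finite (T × (A → Fin n → Prop)))
    -- Tuning inside a cluster must respect the steps that leave it: `w` also records which old
    -- colors are seen through each relation.
    let w : F.carrier → W := fun x => (c x, fun a j => ∃ y ∈ F.depthSet i, F.rel a x y ∧ d y = j)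
    -- One `N` serves all clusters; a cluster may realize fewer than `Nat.card W` values and `f`
    -- need not be monotone, hence the supremum.
    let N := (Finset.range (Nat.card W + 1)).sup f
    have hN : ∀ k ≤ Nat.card W, f k ≤ N := fun k hk =>
      Finset.le_sup (Finset.mem_range.2 (Nat.lt_succ_of_le hk))
    have hcl : ∀ C : Set F.carrier, F.IsClusterIn C → ∃ g : C → Fin N,
        (∀ x y, g x = g y → w x = w y) ∧ ∀ a x x' y, F.rel a x.1 y.1 → g x = g x' →
          ∃ y' : C, F.rel a x'.1 y'.1 ∧ g y' = g y := fun C hC =>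
      exists_tuned_coloring (hf (F.restrict C) ⟨F, rfl, C, hC, rfl⟩) (fun x => w x.1) hN
    let cl : F.carrier → Set F.carrier := fun x => {y | F.reach x y ∧ F.reach y x}
    have hclI : ∀ x, F.IsClusterIn (cl x) := fun x => ⟨x, rfl⟩
    have hself : ∀ x, x ∈ cl x := fun x => ⟨.refl, .refl⟩
    have hcl_eq : ∀ {x y}, y ∈ cl x → cl y = cl x := by
      rintro x y ⟨h₁, h₂⟩
      ext z
      exact ⟨fun h => ⟨.trans h₁ h.1, .trans h.2 h₂⟩, fun h => ⟨.trans h₂ h.1, .trans h.2 h₁⟩⟩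
    choose g hgw hgt using hcl
    let col : F.carrier → Fin N := fun x => g (cl x) (hclI x) ⟨x, hself x⟩
    have hcol : ∀ {x y} (h : y ∈ cl x), col y = g (cl x) (hclI x) ⟨y, h⟩ := by
      intro x y h
      have key : ∀ (C : Set F.carrier) (hC : F.IsClusterIn C) (hy : y ∈ C), C = cl x →
          g C hC ⟨y, hy⟩ = g (cl x) (hclI x) ⟨y, h⟩ := by
        rintro C hC hy rfl; rfl
      exact key _ _ _ (hcl_eq h)
    -- Colors in different clusters are unrelated, so `τ` lists the colored transitions inside the
    -- cluster. It records `w v` because a color determines `w` only within one cluster.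
    let τ : F.carrier → A → Fin N → Fin N → W → Prop := fun x a j k ω =>
      ∃ u ∈ cl x, ∃ v ∈ cl x, F.rel a u v ∧ col u = j ∧ col v = k ∧ w v = ω
    have hτ : ∀ {x y}, y ∈ cl x → τ y = τ x := fun h => by simp only [τ, hcl_eq h]
    have htuned : ∀ a x x' y, y ∈ cl x → F.rel a x y → τ x = τ x' → col x = col x' →
        ∃ y' ∈ cl x', F.rel a x' y' ∧ col y' = col y ∧ w y' = w y := by
      intro a x x' y hy hxy hτx hcx
      have h₁ : τ x a (col x) (col y) (w y) := ⟨x, hself x, y, hy, hxy, rfl, rfl, rfl⟩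
      rw [hτx, hcx] at h₁
      obtain ⟨u, hu, v, hv, huv, h₂, h₃, h₄⟩ := h₁
      rw [hcol hu] at h₂
      -- Equality of the `τ`'s yields a similar transition from some `u` in the cluster of `x'`;
      -- tuning there moves its start to `x'`.
      obtain ⟨v', hv', h₅⟩ := hgt (cl x') (hclI x') a ⟨u, hu⟩ ⟨x', hself x'⟩ ⟨v, hv⟩ huv h₂
      refine ⟨v'.1, v'.2, hv', ?_, (hgw _ _ _ _ h₅).trans h₄⟩
      rw [hcol v'.2, ← h₃, hcol hv]
      exact h₅
    let D : F.carrier → Fin n ⊕ ((A → Fin N → Fin N → W → Prop) × Fin N × W) := fun x =>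
      if x ∈ F.depthSet i then .inl (d x) else .inr (τ x, col x, w x)
    have hD₁ : ∀ {x}, x ∈ F.depthSet i → D x = .inl (d x) := fun h => if_pos h
    have hD₂ : ∀ {x}, x ∉ F.depthSet i → D x = .inr (τ x, col x, w x) := fun h => if_neg h
    have hcases : ∀ {x y}, D x = D y →
        (x ∈ F.depthSet i ∧ y ∈ F.depthSet i ∧ d x = d y) ∨
        (x ∉ F.depthSet i ∧ y ∉ F.depthSet i ∧ τ x = τ y ∧ col x = col y ∧ w x = w y) := by
      intro x y h
      by_cases hx : x ∈ F.depthSet i <;> by_cases hy : y ∈ F.depthSet i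
      · rw [hD₁ hx, hD₁ hy] at h
        exact .inl ⟨hx, hy, Sum.inl_injective h⟩
      · rw [hD₁ hx, hD₂ hy] at h
        cases h
      · rw [hD₂ hx, hD₁ hy] at h
        cases h
      · rw [hD₂ hx, hD₂ hy] at h
        have h := Sum.inr_injective h
        exact .inr ⟨hx, hy, congrArg Prod.fst h, congrArg (fun p => p.2.1) h,
          congrArg (fun p => p.2.2) h⟩
    let e := Finite.equivFin (Fin n ⊕ ((A → Fin N → Fin N → W → Prop) × Fin N × W))
    refine ⟨_, fun x => e (D x), fun x hx y hy h => ?_, fun a x hx x' hx' y hxy h => ?_⟩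
    · rcases hcases (e.injective h) with ⟨h₁, h₂, h₃⟩ | ⟨-, -, -, -, h₃⟩
      · exact hdc x h₁ y h₂ h₃
      · exact congrArg Prod.fst h₃
    · have hr : ∀ {x y}, F.rel a x y → F.reach x y := fun h => .single ⟨a, h⟩
      rcases hcases (e.injective h) with ⟨h₁, h₂, h₃⟩ | ⟨h₁, h₂, h₃, h₄, h₅⟩
      · obtain ⟨y', hy', h'⟩ := hdt a x h₁ x' h₂ y hxy h₃
        refine ⟨y', hy', congrArg e ?_⟩
        rw [hD₁ (mem_depthSet_of_reach h₂ (hr hy')), hD₁ (mem_depthSet_of_reach h₁ (hr hxy)), h']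
      -- A step from `x` either drops to depth at most `i`, controlled by `w`, or stays in the
      -- cluster, controlled by `τ` and `col`.
      · by_cases hy : y ∈ F.depthSet i
        · have h₆ : (w x).2 a (d y) := ⟨y, hy, hxy, rfl⟩
          rw [h₅] at h₆
          obtain ⟨y', hy'i, hy', h'⟩ := h₆
          exact ⟨y', hy', congrArg e (by rw [hD₁ hy, hD₁ hy'i, h'])⟩
        · have hyx : y ∈ cl x := ⟨hr hxy, (hx y (hr hxy)).resolve_right hy⟩
          obtain ⟨y', hy'x, hy', h₆, h₇⟩ := htuned a x x' y hyx hxy h₃ h₄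
          have hy'i : y' ∉ F.depthSet i := fun hc => h₂ (mem_depthSet_of_reach hc hy'x.2)
          refine ⟨y', hy', congrArg e ?_⟩
          rw [hD₂ hy, hD₂ hy'i, hτ hyx, hτ hy'x, h₃, h₆, h₇]

/-- The color of a point determines the truth values of formulas, if the coloring is tuned and
determines the values of the variables. -/
theorem sat_iff_of_tuned {F : KripkeFrame A} {θ : ℕ → Set F.carrier} {T : Type*}
    {d : F.carrier → T} {k : ℕ} (hθ : ∀ n < k, ∀ x y, d x = d y → (x ∈ θ n ↔ y ∈ θ n))
    (hd : ∀ a x x' y, F.rel a x y → d x = d x' → ∃ y', F.rel a x' y' ∧ d y' = d y)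
    {φ : Formula A} (hφ : φ.IsKFormula k) {x y : F.carrier} (h : d x = d y) :
    F.Sat θ φ x ↔ F.Sat θ φ y := by
  induction φ generalizing x y with
  | var n => exact hθ n hφ x y h
  | bot => rfl
  | imp φ ψ h₁ h₂ => exact imp_congr (h₁ hφ.1 h) (h₂ hφ.2 h)
  | dia a φ ih =>
    have key : ∀ {x y}, d x = d y → F.Sat θ (dia a φ) x → F.Sat θ (dia a φ) y := by
      rintro x y h ⟨z, hz, h'⟩
      obtain ⟨z', hz', he⟩ := hd a x y z hz h
      exact ⟨z', hz', (ih hφ he.symm).1 h'⟩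
    exact ⟨key h, key h.symm⟩

end KripkeFrame

theorem UniformlyTunable.mono {K K' : Set (KripkeFrame A)} (h : UniformlyTunable K')
    (hK : K ⊆ K') : UniformlyTunable K :=
  h.imp fun _ hf F hF => hf F (hK hF)

/-! ### The canonical frame of a logic of finite height -/

/-- The maximal `L`-consistent sets are the maximal `L₀`-consistent sets containing `L`. They are
closed under successors: if `ψ ∈ L` failed at a successor of `Γ`, then `◇¬ψ`, hence `◇⊥`, would be
in `Γ`. -/
theorem isFrameOf_canonicalFrame_of_isExtension {L₀ L : Set (Formula A)} (h₀ : IsNormalLogic L₀)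
    (hcan : IsCanonical L₀) (hL : IsExtension L₀ L) : (canonicalFrame L).IsFrameOf L₀ := by
  have hcons : ∀ {Γ}, IsConsistent L Γ → IsConsistent L₀ Γ := fun h l hl hc => h l hl (hL.2 hc)
  have hmax : ∀ {Γ}, Maximal (IsConsistent L) Γ → Maximal (IsConsistent L₀) Γ := by
    refine fun {Γ} hΓ => ⟨hcons hΓ.1, fun Δ hΔ hsub φ hφ => ?_⟩
    by_contra hc
    have h₁ := hsub (((isBoolean_mem hL.1 hΓ).neg φ).2 hc)
    refine isConsistent_iff.1 hΔ (.mp h₀ (.of_mem h₀ h₁) (.of_mem h₀ hφ))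
  have hmax' : ∀ {Γ}, Maximal (IsConsistent L₀) Γ → L ⊆ Γ → Maximal (IsConsistent L) Γ := by
    refine fun {Γ} hΓ hsub => ⟨fun l hl hc => ?_, fun Δ hΔ h => hΓ.2 (hcons hΔ) h⟩
    have hB := isBoolean_mem h₀ hΓ
    exact (hB.neg _).1 (hsub hc) ((hB.conj l).2 hl)
  let e : (canonicalFrame L).carrier → (canonicalFrame L₀).carrier := fun Γ => ⟨Γ.1, hmax Γ.2⟩
  have he : e.Injective := fun Γ Δ h => Subtype.ext (congrArg Subtype.val h :)
  intro φ hφ θ x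
  refine (KripkeFrame.sat_image_iff he (fun _ _ _ => Iff.rfl) ?_ θ φ x).1 (hcan φ hφ _ _)
  intro a Γ Δ hΓΔ
  refine ⟨⟨Δ.1, hmax' Δ.2 fun ψ hψ => ?_⟩, rfl⟩
  by_contra hc
  have h₁ : dia a (neg ψ) ∈ Γ.1 := hΓΔ _ (((isBoolean_mem h₀ Δ.2).neg ψ).2 hc)
  have h₂ : imp (dia a (neg ψ)) (dia a bot) ∈ L := by
    refine hL.1.monotonicity a _ _ (hL.1.mem_of_mem hψ fun v hv => ?_)
    simp only [hv.imp, hv.neg]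
    tauto
  exact ((isBoolean_mem hL.1 Γ.2).neg _).1 (mem_of_mem_logic hL.1 Γ.2 (hL.1.dia_bot a))
    (mem_of_imp_mem hL.1 Γ.2 h₂ h₁)

variable [Fintype A] {L : Set (Formula A)}

/-- As `A` is finite, a single first modality works for all `φ`: otherwise the conjunction of one
counterexample per modality contradicts `h`. The formulas `◇^i φ` with `φ` true at `x` are directed,
so they have a common successor. -/
theorem steps_of_forall (hL : IsNormalLogic L) {x : (canonicalFrame L).carrier} (i : ℕ)
    {y : (canonicalFrame L).carrier} (h : ∀ φ, CSat L φ x → CSat L (diaIter i φ) y) :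
    (canonicalFrame L).steps i y x := by
  induction i generalizing y with
  | zero =>
    refine Subtype.ext (Set.ext fun φ => ?_)
    rw [← csat_iff_mem hL, ← csat_iff_mem hL]
    exact ⟨fun hy => by_contra fun hx => h (neg φ) hx hy, h φ⟩
  | succ i ih =>
    have ha : ∃ a, ∀ φ, CSat L φ x → CSat L (dia a (diaIter i φ)) y := by
      by_contra! hc
      choose φ hφ hφ' using hc
      have h₁ := h (conj ((Finset.univ : Finset A).toList.map φ))
        ((KripkeFrame.sat_conj _ _ _ x).2 (by
          simp only [List.mem_map, forall_exists_index, and_imp, forall_apply_eq_imp_iff₂]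
          exact fun a _ => hφ a))
      obtain ⟨z, ⟨a, hz⟩, h₂⟩ := (KripkeFrame.sat_diaAll _ _ _ y).1 h₁
      obtain ⟨t, ht, h₃⟩ := (KripkeFrame.sat_diaIter _ _ _ _ _).1 h₂
      refine hφ' a ⟨z, hz, (KripkeFrame.sat_diaIter _ _ _ _ _).2 ⟨t, ht, ?_⟩⟩
      exact (KripkeFrame.sat_conj _ _ _ t).1 h₃ _ (List.mem_map_of_mem (by simp))
    obtain ⟨a, ha⟩ := ha
    have hmono : ∀ {φ ψ : Formula A}, (∀ z, CSat L φ z → CSat L ψ z) →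
        imp (diaIter i φ) (diaIter i ψ) ∈ L := fun hφψ => (mem_iff_csat hL _).2 fun z hz => by
      obtain ⟨t, ht, h'⟩ := (KripkeFrame.sat_diaIter _ _ _ _ _).1 hz
      exact (KripkeFrame.sat_diaIter _ _ _ _ _).2 ⟨t, ht, hφψ t h'⟩
    obtain ⟨Δ, hΔ, hsub, hrel⟩ := exists_rel_of_directed hL y.2 a
      (S := {ψ | ∃ φ, CSat L φ x ∧ diaIter i φ = ψ}) ⟨_, neg bot, id, rfl⟩
      (by
        rintro _ ⟨φ, hφ, rfl⟩ _ ⟨ψ, hψ, rfl⟩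
        exact ⟨_, ⟨and φ ψ, (KripkeFrame.sat_and _ _ _ _ x).2 ⟨hφ, hψ⟩, rfl⟩,
          hmono fun z hz => ((KripkeFrame.sat_and _ _ _ _ z).1 hz).1,
          hmono fun z hz => ((KripkeFrame.sat_and _ _ _ _ z).1 hz).2⟩)
      (by
        rintro _ ⟨φ, hφ, rfl⟩
        exact (csat_iff_mem hL _ y).1 (ha φ hφ))
    exact ⟨⟨Δ, hΔ⟩, ⟨a, hrel⟩, ih fun φ hφ => (csat_iff_mem hL _ _).2 (hsub ⟨φ, hφ, rfl⟩)⟩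

/-- The same conjunction argument, over the path lengths up to `m`, finds one length that works for
all `φ`. -/
theorem reach_of_forall (hL : IsNormalLogic L) {m : ℕ} {x y : (canonicalFrame L).carrier}
    (h : ∀ φ, CSat L φ x → CSat L (diaLe m φ) y) : (canonicalFrame L).reach y x := by
  have hi : ∃ i, ∀ φ, CSat L φ x → CSat L (diaIter i φ) y := by
    by_contra! hc
    choose φ hφ hφ' using hc
    have h₁ := h (conj ((List.range (m + 1)).map φ))
      ((KripkeFrame.sat_conj _ _ _ x).2 (by
        simp only [List.mem_map, forall_exists_index, and_imp, forall_apply_eq_imp_iff₂]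
        exact fun i _ => hφ i))
    obtain ⟨i, hi, z, hz, h₂⟩ := (KripkeFrame.sat_diaLe _ _ _ _ y).1 h₁
    refine hφ' i ((KripkeFrame.sat_diaIter _ _ _ _ _).2 ⟨z, hz, ?_⟩)
    exact (KripkeFrame.sat_conj _ _ _ z).1 h₂ _
      (List.mem_map_of_mem (List.mem_range.2 (Nat.lt_succ_of_le hi)))
  obtain ⟨i, hi⟩ := hi
  exact KripkeFrame.reach_of_steps _ (steps_of_forall hL i hi)

theorem subst_heightFormula_succ (σ : ℕ → Formula A) (m h : ℕ) :
    subst σ (heightFormula A m (h + 1)) = imp (σ (h + 1))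
      (boxLe m (or (diaLe m (σ (h + 1))) (subst σ (heightFormula A m h)))) := by
  simp [heightFormula, subst, boxLe, neg, Formula.or, subst_diaLe]

theorem subst_heightFormula_congr {σ σ' : ℕ → Formula A} {h : ℕ} (hσ : ∀ n ≤ h, σ n = σ' n)
    (m : ℕ) : subst σ (heightFormula A m h) = subst σ' (heightFormula A m h) := by
  induction h with
  | zero => rfl
  | succ h ih =>
    rw [subst_heightFormula_succ, subst_heightFormula_succ, hσ _ le_rfl,
      ih fun n hn => hσ n (hn.trans (Nat.le_succ h))]

/-- Substitution instances replace arbitrary valuations, as the canonical frame of `L` need not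
validate `L`. -/
theorem mem_depthSet_of_forall (hL : IsNormalLogic L) {m : ℕ} (ht : transFormula A m ∈ L) {h : ℕ}
    {x : (canonicalFrame L).carrier} (hx : ∀ σ, CSat L (subst σ (heightFormula A m h)) x) :
    x ∈ (canonicalFrame L).depthSet h := by
  induction h generalizing x with
  | zero => exact hx var
  | succ h ih =>
    intro y hxy
    by_contra! hc
    obtain ⟨h₁, h₂⟩ := hc
    obtain ⟨φ, hφ, hφ'⟩ : ∃ φ, CSat L φ x ∧ ¬ CSat L (diaLe m φ) y := by
      by_contra! hc
      exact h₁ (reach_of_forall hL hc)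
    obtain ⟨σ, hσ⟩ : ∃ σ, ¬ CSat L (subst σ (heightFormula A m h)) y := by
      by_contra! hc
      exact h₂ (ih hc)
    -- The height formula for `h` has no variable beyond `p_h`, so `p_{h+1}` is free to carry `φ`.
    have h₃ := hx fun n => if n = h + 1 then φ else σ n
    rw [subst_heightFormula_succ, if_pos rfl, subst_heightFormula_congr (σ' := σ)
      fun n hn => if_neg (by omega)] at h₃
    exact ((KripkeFrame.sat_or _ _ _ _ y).1 ((csat_boxLe hL ht _ x).1 (h₃ hφ) y hxy)).elim hφ' hσ

omit [Fintype A] in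
theorem kFinite_of_finite {L : Set (Formula A)} {k : ℕ} {T : Type*} [Finite T] (g : Formula A → T)
    (h : ∀ φ ψ : Formula A, φ.IsKFormula k → ψ.IsKFormula k → g φ = g ψ → iff φ ψ ∈ L) :
    KFinite k L := by
  classical
  let r : T → Formula A := fun t =>
    if ht : ∃ φ : Formula A, φ.IsKFormula k ∧ g φ = t then ht.choose else bot
  refine ⟨Set.range r, Set.finite_range r, fun φ hφ => ⟨r (g φ), ⟨_, rfl⟩, ?_⟩⟩
  have ht : ∃ ψ : Formula A, ψ.IsKFormula k ∧ g ψ = g φ := ⟨φ, hφ, rfl⟩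
  have hr : r (g φ) = ht.choose := dif_pos ht
  rw [hr]
  exact ⟨ht.choose_spec.1, h _ _ hφ ht.choose_spec.1 ht.choose_spec.2.symm⟩

theorem locallyTabular_of_heightFormula_mem {L₀ : Set (Formula A)} (h₀ : IsNormalLogic L₀)
    (hcan : IsCanonical L₀) (hripe : HasRipeClusterProperty L₀) (hL : IsExtension L₀ L)
    {m h : ℕ} (ht : transFormula A m ∈ L) (hh : heightFormula A m h ∈ L) :
    LocallyTabular L := by
  intro k
  have hF : UniformlyTunable (clusterFrames {canonicalFrame L}) := by
    refine UniformlyTunable.mono hripe ?_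
    rintro _ ⟨_, rfl, C, hC, rfl⟩
    exact ⟨_, isFrameOf_canonicalFrame_of_isExtension h₀ hcan hL, C, hC, rfl⟩
  have hmem : ∀ x, x ∈ (canonicalFrame L).depthSet h := fun x =>
    mem_depthSet_of_forall hL.1 ht fun σ => (mem_iff_csat hL.1 _).1 (hL.1.substitution σ _ hh) x
  obtain ⟨n, d, hd₁, hd₂⟩ := (canonicalFrame L).exists_tuned_coloring_depthSet hF
    (fun x (i : Fin k) => x ∈ canonicalVal L i) h
  have hsat : ∀ {φ : Formula A}, φ.IsKFormula k → ∀ {x y}, d x = d y →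
      (CSat L φ x ↔ CSat L φ y) := fun hφ => KripkeFrame.sat_iff_of_tuned
    (fun n hn x y hxy => (congrFun (hd₁ x (hmem x) y (hmem y) hxy) ⟨n, hn⟩).to_iff)
    (fun a x x' y => hd₂ a x (hmem x) x' (hmem x') y) hφ
  -- A `k`-formula is determined up to equivalence by the set of colors of the points satisfying it.
  refine kFinite_of_finite (fun φ => {j : Fin n | ∃ x, d x = j ∧ CSat L φ x})
    fun φ ψ hφ hψ he => (iff_mem_iff hL.1 φ ψ).2 ?_
  have key : ∀ {φ ψ : Formula A}, ψ.IsKFormula k →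
      {j : Fin n | ∃ x, d x = j ∧ CSat L φ x} = {j : Fin n | ∃ x, d x = j ∧ CSat L ψ x} →
      ∀ x, CSat L φ x → CSat L ψ x := by
    intro φ ψ hψ he x hx
    have : d x ∈ {j : Fin n | ∃ x, d x = j ∧ CSat L ψ x} := he ▸ ⟨x, rfl, hx⟩
    obtain ⟨y, hy, h'⟩ := this
    exact (hsat hψ hy).1 h'
  exact fun x => ⟨key hψ he x, key hφ he.symm x⟩

/-! ### Fragments -/

omit [Fintype A] in
theorem mapModality_subst {B : Type u} (g : B → A) (σ : ℕ → Formula B) (φ : Formula B) :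
    mapModality g (subst σ φ) = subst (fun n => mapModality g (σ n)) (mapModality g φ) := by
  induction φ with
  | var n => rfl
  | bot => rfl
  | imp φ ψ h₁ h₂ => simp [mapModality, subst, h₁, h₂]
  | dia a φ h => simp [mapModality, subst, h]

omit [Fintype A] in
theorem IsKFormula.mapModality {B : Type u} (g : B → A) {k : ℕ} {φ : Formula B}
    (h : φ.IsKFormula k) : (mapModality g φ).IsKFormula k := by
  induction φ with
  | var n => exact h
  | bot => trivial
  | imp φ ψ h₁ h₂ => exact ⟨h₁ h.1, h₂ h.2⟩
  | dia a φ ih => exact ih h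

omit [Fintype A] in
theorem isNormalLogic_fragment (hL : IsNormalLogic L) (B : Finset A) :
    IsNormalLogic (fragment L B) where
  tautology φ hφ := hL.mem_of_forall fun v hv =>
    hφ (fun ψ => v (mapModality Subtype.val ψ)) hv.bot fun ψ χ => hv.imp _ _
  dia_bot a := hL.dia_bot a.1
  dia_or a := hL.dia_or a.1
  modusPonens φ ψ h h' := hL.modusPonens _ _ h h'
  substitution σ φ h := by
    rw [fragment, Set.mem_ofPred_eq, mapModality_subst]
    exact hL.substitution _ _ h
  monotonicity a φ ψ h := hL.monotonicity a.1 _ _ h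

-- Representatives in `S` may use modalities outside `B`, so they only index the equivalence
-- classes.
omit [Fintype A] in
theorem KFinite.fragment (hL : IsNormalLogic L) {k : ℕ} (h : KFinite k L) (B : Finset A) :
    KFinite k (fragment L B) := by
  classical
  obtain ⟨S, hS, h⟩ := h
  have := hS.to_subtype
  choose! r hr hrk hri using h
  refine kFinite_of_finite (fun φ => open Classical in
    if hφ : φ.IsKFormula k then some (⟨_, hr _ (IsKFormula.mapModality Subtype.val hφ)⟩ : S)
    else none) fun φ ψ hφ hψ he => ?_
  rw [dif_pos hφ, dif_pos hψ] at he
  have he := congrArg Subtype.val (Option.some_injective _ he)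
  have h₁ := (iff_mem_iff hL _ _).1 (hri _ (IsKFormula.mapModality Subtype.val hφ))
  have h₂ := (iff_mem_iff hL _ _).1 (hri _ (IsKFormula.mapModality Subtype.val hψ))
  refine (iff_mem_iff hL (mapModality Subtype.val φ) (mapModality Subtype.val ψ)).2 fun x => ?_
  rw [h₁ x, h₂ x]
  exact iff_of_eq (congrArg (CSat L · x) he)

theorem exists_mem_of_logicHeight_fragment_lt_top (hL : IsNormalLogic L)
    (h : logicHeight (fragment L Finset.univ) < ⊤) :
    ∃ m n, transFormula A m ∈ L ∧ heightFormula A m n ∈ L := by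
  obtain ⟨m, n, hm, hn⟩ := exists_mem_of_logicHeight_lt_top h
  have hs : Function.Surjective (Subtype.val (p := (· ∈ (Finset.univ : Finset A)))) :=
    fun a => ⟨⟨a, Finset.mem_univ a⟩, rfl⟩
  refine ⟨m, n, (mem_iff_csat hL _).2 fun x => ?_, (mem_iff_csat hL _).2 fun x => ?_⟩
  · exact (KripkeFrame.sat_mapModality_transFormula _ _ hs m x).1 ((mem_iff_csat hL _).1 hm x)
  · exact (KripkeFrame.sat_mapModality_heightFormula _ _ hs m n x).1 ((mem_iff_csat hL _).1 hn x)

end PolyModal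

/-! ### The main theorem -/

theorem mainTheorem3 {A : Type u} [Fintype A] (L₀ : Set (PolyModal.Formula A))
    (hnormal : PolyModal.IsNormalLogic L₀)
    (hcanonical : PolyModal.IsCanonical L₀)
    (hpretransitive : PolyModal.IsPretransitive L₀)
    (hripe : PolyModal.HasRipeClusterProperty L₀) :
    (∀ L : Set (PolyModal.Formula A), PolyModal.IsExtension L₀ L →
      (PolyModal.LocallyTabular L ↔ PolyModal.logicHeight L < ⊤)) ∧
    PolyModal.AdmitsFiniteHeightCriterion L₀ ∧
    PolyModal.AdmitsKFinitenessCondition 1 L₀ := by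
  have key : ∀ L : Set (PolyModal.Formula A), PolyModal.IsExtension L₀ L →
      PolyModal.logicHeight L < ⊤ → PolyModal.LocallyTabular L := fun L hL h => by
    obtain ⟨m, n, hm, hn⟩ := PolyModal.exists_mem_of_logicHeight_lt_top h
    exact PolyModal.locallyTabular_of_heightFormula_mem hnormal hcanonical hripe hL hm hn
  refine ⟨fun L hL => ⟨fun h => ?_, key L hL⟩, fun L hL => ⟨fun h B => ?_, fun h => ?_⟩,
    fun L hL h => key L hL (PolyModal.logicHeight_lt_top_of_kFinite hL.1 h)⟩
  · exact PolyModal.logicHeight_lt_top_of_kFinite hL.1 (h 1)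
  · exact PolyModal.logicHeight_lt_top_of_kFinite (PolyModal.isNormalLogic_fragment hL.1 B)
      ((h 1).fragment hL.1 B)
  · obtain ⟨m, n, hm, hn⟩ :=
      PolyModal.exists_mem_of_logicHeight_fragment_lt_top hL.1 (h Finset.univ)
    exact PolyModal.locallyTabular_of_heightFormula_mem hnormal hcanonical hripe hL hm hn
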